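/- All rings are commutative. Let $R$ be a Noetherian local ring with maximal ideal $\mathfrak m$. For an $R$-module $M$ put $M^{*}=\operatorname{Hom}_R(M,R)$. A finitely generated $R$-module $M$ is called totally reflexive if the natural homomorphism $M\to M^{**}$ is an isomorphism and $\operatorname{Ext}_R^i(M,R)=0=\operatorname{Ext}_R^i(M^{*},R)$ for all $i>0$. The ring $R$ is called G-regular if every totally reflexive $R$-module is free. Elements $x,y\in\mathfrak m$ form a pair of exact zerodivisors $\{x,y\}$ of $R$ if $(0:x)=(y)$ and $(0:y)=(x)$. Proposition. Let $(S,\mathfrak n)$ be a Noetherian local ring, let $x,y\in\mathfrak n$, and let $R=S/(xy)$. Assume that $S$ is G-regular, that $x$ and $y$ are nonzerodivisors of $S$, that $x\notin\mathfrak n^2$, and that $\dim S/(x,y)\ge 2$ (Krull dimension). Then (the images of) $\{x,y\}$ form a pair of exact zerodivisors of the local ring $R$, $\dim R/(x,y)\ge 2$, and the local ring $R/(x)$ is G-regular. -/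

import Mathlib

universe u

/-- A finitely generated module `M` over a commutative Noetherian ring `R` is totally reflexive if
the biduality map `M → M**` is an isomorphism and `Ext^i(M, R) = 0 = Ext^i(M*, R)` for all
`i > 0`, where `M* = Hom(M, R)`. -/
structure IsTotallyReflexive (R : Type u) [CommRing R] [IsNoetherianRing R]
    (M : Type u) [AddCommGroup M] [Module R M] : Prop where
  finite : Module.Finite R M
  bijective_eval : Function.Bijective (Module.Dual.eval R M)
  ext_self : ∀ i : ℕ, 0 < i →
    Subsingleton (CategoryTheory.Abelian.Ext (ModuleCat.of R M) (ModuleCat.of R R) i)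
  ext_dual : ∀ i : ℕ, 0 < i →
    Subsingleton
      (CategoryTheory.Abelian.Ext (ModuleCat.of R (Module.Dual R M)) (ModuleCat.of R R) i)

/-- A Noetherian local ring is G-regular if all its totally reflexive modules are free. -/
def IsGRegular (R : Type u) [CommRing R] [IsNoetherianRing R] [IsLocalRing R] : Prop :=
  ∀ (M : Type u) [AddCommGroup M] [Module R M], IsTotallyReflexive R M → Module.Free R M

/-- `{x, y}` is a pair of exact zerodivisors of the Noetherian local ring `R` with maximal ideal
`𝔪`: both elements lie in `𝔪`, `(0 : x) = (y)` and `(0 : y) = (x)`. -/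
structure IsExactZerodivisorPair {R : Type u} [CommRing R] [IsNoetherianRing R] [IsLocalRing R]
    (x y : R) : Prop where
  left_mem : x ∈ IsLocalRing.maximalIdeal R
  right_mem : y ∈ IsLocalRing.maximalIdeal R
  colon_left : (⊥ : Ideal R).colon {x} = Ideal.span {y}
  colon_right : (⊥ : Ideal R).colon {y} = Ideal.span {x}

/-! Since `xy` is a multiple of `x`, the ring `R/(x)` is `A = S/(x)`, so the main claim is that
G-regularity passes from `S` to `A`. Let `M` be totally reflexive over `A` and `0 → N → F → M → 0` a
minimal cover over `S` with `F` free of rank `n`. Dualizing gives `0 → F* → N* → Hom_A(M, A) → 0`, a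
concrete form of `Ext¹_S(M, S) ≅ Hom_A(M, A)`. With the vanishing of `Ext_S^{≥2}`, this makes `N`
totally reflexive over `S` (`isTotallyReflexive_ker`), hence free. Now `xF ⊆ N ⊆ 𝔫F`, so `N` has
rank `n`. If `xF ≠ N`, some `v ∉ 𝔫F` has `xv ∈ 𝔫N ⊆ 𝔫²F`, forcing `x ∈ 𝔫²`. Hence `N = xF` and `M ≅
Aⁿ` (`free_of_free_ker`). The exact zerodivisor property is cancellation in `S`, and the dimension
bound holds because `R/(x, y) = S/(x, y)`. -/

open CategoryTheory CategoryTheory.Abelian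

/-! ### Vanishing of Ext along short exact sequences -/

section ShortExact

variable {R : Type u} [CommRing R] {K P M Y : Type u}
  [AddCommGroup K] [Module R K] [AddCommGroup P] [Module R P] [AddCommGroup M] [Module R M]
  [AddCommGroup Y] [Module R Y]

theorem shortExact_of_exact {f : K →ₗ[R] P} {g : P →ₗ[R] M} (hf : Function.Injective f)
    (hg : Function.Surjective g) (h : Function.Exact f g) :
    (ModuleCat.shortComplexOfCompEqZero f g h.linearMap_comp_eq_zero).ShortExact :=
  ModuleCat.shortComplex_shortExact _ h hf hg

/-- Linear maps from `K` extend along `K → P` if `Ext¹(P/K, -)` vanishes. -/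
theorem exists_extension_of_ext_one {f : K →ₗ[R] P} {g : P →ₗ[R] M} (hf : Function.Injective f)
    (hg : Function.Surjective g) (h : Function.Exact f g)
    (hM : Subsingleton (Ext (ModuleCat.of R M) (ModuleCat.of R Y) 1)) (φ : K →ₗ[R] Y) :
    ∃ ψ : P →ₗ[R] Y, ψ ∘ₗ f = φ := by
  obtain ⟨e, he⟩ := Ext.contravariant_sequence_exact₁ (shortExact_of_exact hf hg h)
    (ModuleCat.of R Y) (Ext.mk₀ (ModuleCat.ofHom φ)) (n₁ := 1) rfl (hM.elim _ _)
  obtain ⟨e, rfl⟩ := Ext.addEquiv₀.symm.surjective e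
  refine ⟨e.hom, ?_⟩
  rw [Ext.addEquiv₀_symm_apply, Ext.mk₀_comp_mk₀] at he
  have := (Ext.mk₀_bijective _ _).1 he
  exact congrArg ModuleCat.Hom.hom this

/-- Vanishing of `Ext` at the outer terms implies vanishing in the middle. -/
theorem subsingleton_ext_of_exact_middle {f : K →ₗ[R] P} {g : P →ₗ[R] M}
    (hf : Function.Injective f) (hg : Function.Surjective g) (h : Function.Exact f g) (i : ℕ)
    (hK : Subsingleton (Ext (ModuleCat.of R K) (ModuleCat.of R Y) i))
    (hM : Subsingleton (Ext (ModuleCat.of R M) (ModuleCat.of R Y) i)) :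
    Subsingleton (Ext (ModuleCat.of R P) (ModuleCat.of R Y) i) := by
  refine subsingleton_of_forall_eq 0 fun e ↦ ?_
  obtain ⟨e', rfl⟩ := Ext.contravariant_sequence_exact₂ (shortExact_of_exact hf hg h)
    (ModuleCat.of R Y) e (hK.elim _ _)
  rw [show e' = 0 from hM.elim _ _, Ext.comp_zero]

theorem subsingleton_ext_of_exact_left {f : K →ₗ[R] P} {g : P →ₗ[R] M}
    (hf : Function.Injective f) (hg : Function.Surjective g) (h : Function.Exact f g) (i : ℕ)
    (hP : Subsingleton (Ext (ModuleCat.of R P) (ModuleCat.of R Y) i))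
    (hM : Subsingleton (Ext (ModuleCat.of R M) (ModuleCat.of R Y) (i + 1))) :
    Subsingleton (Ext (ModuleCat.of R K) (ModuleCat.of R Y) i) := by
  refine subsingleton_of_forall_eq 0 fun e ↦ ?_
  obtain ⟨e', rfl⟩ := Ext.contravariant_sequence_exact₁ (shortExact_of_exact hf hg h)
    (ModuleCat.of R Y) e (add_comm 1 i) (hM.elim _ _)
  rw [show e' = 0 from hP.elim _ _, Ext.comp_zero]

theorem subsingleton_ext_of_exact_right {f : K →ₗ[R] P} {g : P →ₗ[R] M}
    (hf : Function.Injective f) (hg : Function.Surjective g) (h : Function.Exact f g) (i : ℕ)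
    (hK : Subsingleton (Ext (ModuleCat.of R K) (ModuleCat.of R Y) i))
    (hP : Subsingleton (Ext (ModuleCat.of R P) (ModuleCat.of R Y) (i + 1))) :
    Subsingleton (Ext (ModuleCat.of R M) (ModuleCat.of R Y) (i + 1)) := by
  refine subsingleton_of_forall_eq 0 fun e ↦ ?_
  obtain ⟨e', rfl⟩ := Ext.contravariant_sequence_exact₃ (shortExact_of_exact hf hg h)
    (ModuleCat.of R Y) e (hP.elim _ _) (add_comm 1 i)
  rw [show e' = 0 from hK.elim _ _, Ext.comp_zero]

theorem subsingleton_ext_of_projective [Module.Projective R P] (i : ℕ) (hi : 0 < i) :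
    Subsingleton (Ext (ModuleCat.of R P) (ModuleCat.of R Y) i) := by
  have : Projective (ModuleCat.of R P) := (IsProjective.iff_projective P).1 inferInstance
  obtain ⟨i, rfl⟩ := Nat.exists_eq_add_of_lt hi
  exact subsingleton_of_forall_eq 0 Ext.eq_zero_of_projective

end ShortExact

/-! ### Change of rings modulo a nonzerodivisor -/

/-- `A` is the quotient of `S` by the nonzerodivisor `x`. -/
structure IsRegularQuotient (S A : Type u) [CommRing S] [CommRing A] [Algebra S A] (x : S) :
    Prop where
  surjective : Function.Surjective (algebraMap S A)
  algebraMap_eq_zero_iff : ∀ s : S, algebraMap S A s = 0 ↔ x ∣ s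
  regular : x ∈ nonZeroDivisors S

/-- `Ext^i(M, R) = 0` for all `i > 0`. -/
def ExtSelfVanishes (R : Type u) [CommRing R] (M : Type u) [AddCommGroup M] [Module R M] : Prop :=
  ∀ i : ℕ, 0 < i → Subsingleton (Ext (ModuleCat.of R M) (ModuleCat.of R R) i)

namespace IsRegularQuotient

variable {S A : Type u} [CommRing S] [CommRing A] [Algebra S A] {x : S}

theorem mul_cancel (h : IsRegularQuotient S A x) {a b : S} (hab : x * a = x * b) : a = b :=
  (mul_cancel_left_mem_nonZeroDivisors h.regular).1 hab

theorem algebraMap_self (h : IsRegularQuotient S A x) : algebraMap S A x = 0 :=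
  (h.algebraMap_eq_zero_iff x).2 dvd_rfl

theorem smul_eq_zero (h : IsRegularQuotient S A x) {M : Type*} [AddCommGroup M] [Module A M]
    [Module S M] [IsScalarTower S A M] (m : M) : x • m = 0 := by
  rw [← algebraMap_smul A x m, h.algebraMap_self, zero_smul]

theorem exact (h : IsRegularQuotient S A x) :
    Function.Exact (x • (LinearMap.id : S →ₗ[S] S)) (Algebra.linearMap S A) := fun s ↦ by
  simp only [Algebra.linearMap_apply, h.algebraMap_eq_zero_iff, Set.mem_range]
  exact ⟨fun ⟨c, hc⟩ ↦ ⟨c, by simp [hc]⟩, fun ⟨c, hc⟩ ↦ ⟨c, by simp [← hc]⟩⟩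

theorem injective (h : IsRegularQuotient S A x) :
    Function.Injective (x • (LinearMap.id : S →ₗ[S] S)) := fun _ _ hab ↦ h.mul_cancel hab

theorem shortExact (h : IsRegularQuotient S A x) :
    (ModuleCat.shortComplexOfCompEqZero (x • (LinearMap.id : S →ₗ[S] S)) (Algebra.linearMap S A)
      h.exact.linearMap_comp_eq_zero).ShortExact :=
  shortExact_of_exact h.injective h.surjective h.exact

variable {K : Type u} [AddCommGroup K] [Module S K]

/-- If `x` kills `K`, then the connecting map `Hom(K, A) → Ext¹(K, S)` is surjective. -/
theorem exists_extClass_eq (h : IsRegularQuotient S A x) (hK : ∀ k : K, x • k = 0)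
    (e : Ext (ModuleCat.of S K) (ModuleCat.of S S) 1) :
    ∃ φ : K →ₗ[S] A,
      (Ext.mk₀ (ModuleCat.ofHom φ)).comp h.shortExact.extClass (zero_add 1) = e := by
  -- Scalars act on Ext equally through either argument, so multiplication by `x` on `S` acts as
  -- multiplication by `x` on `K`, which is zero.
  have hz : e.comp (Ext.mk₀ (ModuleCat.ofHom (x • (LinearMap.id : S →ₗ[S] S)))) (add_zero 1)
      = 0 := by
    have h1 : ModuleCat.ofHom (x • (LinearMap.id : S →ₗ[S] S)) = x • 𝟙 (ModuleCat.of S S) := by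
      ext; rfl
    have h2 : x • 𝟙 (ModuleCat.of S K) = 0 := by
      ext k; exact hK k
    rw [h1, ← Ext.smul_eq_comp_mk₀, ← Ext.mk₀_id_comp (x • e), Ext.comp_smul, ← Ext.smul_comp,
      ← Ext.mk₀_smul, h2, Ext.mk₀_zero, Ext.zero_comp]
  obtain ⟨φ, hφ⟩ := Ext.covariant_sequence_exact₁ _ h.shortExact e hz (zero_add 1)
  obtain ⟨φ, rfl⟩ := Ext.addEquiv₀.symm.surjective φ
  exact ⟨φ.hom, hφ⟩

theorem mk₀_comp_extClass_eq_zero (h : IsRegularQuotient S A x) (φ : K →ₗ[S] S) :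
    (Ext.mk₀ (ModuleCat.ofHom (Algebra.linearMap S A ∘ₗ φ))).comp h.shortExact.extClass
      (zero_add 1) = 0 := by
  have : Ext.mk₀ (ModuleCat.ofHom (Algebra.linearMap S A ∘ₗ φ)) =
      (Ext.mk₀ (ModuleCat.ofHom φ)).comp (Ext.mk₀ (ModuleCat.ofHom (Algebra.linearMap S A)))
        (zero_add 0) := by
    rw [Ext.mk₀_comp_mk₀]; rfl
  rw [this, Ext.comp_assoc_of_second_deg_zero]
  exact (congrArg (fun e ↦ (Ext.mk₀ (ModuleCat.ofHom φ)).comp e (zero_add 1))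
    h.shortExact.comp_extClass).trans (Ext.comp_zero _ _ _ _ _)

/-- Multiplication by `x` gives a free `S`-resolution of length one. Arbitrary `ι` allows covers
indexed by all elements of a module. -/
theorem subsingleton_ext_finsupp (h : IsRegularQuotient S A x) (ι : Type u) (i : ℕ) (hi : 2 ≤ i) :
    Subsingleton (Ext (ModuleCat.of S (ι →₀ A)) (ModuleCat.of S S) i) := by
  obtain ⟨i, rfl⟩ := Nat.exists_eq_add_of_le' hi
  refine subsingleton_ext_of_exact_right (f := x • (LinearMap.id : (ι →₀ S) →ₗ[S] (ι →₀ S)))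
    (g := Finsupp.mapRange.linearMap (Algebra.linearMap S A)) ?_ ?_ ?_ (i + 1)
    (subsingleton_ext_of_projective _ (by lia)) (subsingleton_ext_of_projective _ (by lia))
  · intro a b hab
    ext j
    exact h.mul_cancel (by simpa using DFunLike.congr_fun hab j)
  · exact Finsupp.mapRange_surjective _ (map_zero _) h.surjective
  · intro y
    refine ⟨fun hy ↦ ?_, ?_⟩
    · have hd : ∀ j, x ∣ y j := fun j ↦
        (h.algebraMap_eq_zero_iff _).1 (by simpa using DFunLike.congr_fun hy j)
      choose c hc using hd
      refine ⟨Finsupp.onFinset y.support c fun j hj ↦ ?_, ?_⟩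
      · rw [Finsupp.mem_support_iff, hc j]
        exact fun h0 ↦ hj (h.mul_cancel (by rw [h0, mul_zero]))
      · ext j
        simp [hc j]
    · rintro ⟨z, rfl⟩
      ext j
      simp [h.smul_eq_zero]

/-- A class in `Ext²_S(M, S)` comes from `Ext¹_S(K, S)`, hence from a map `K → A`. That map extends
to `P`, so the connecting map kills the class. -/
theorem subsingleton_ext_two (h : IsRegularQuotient S A x) {K P M : Type u}
    [AddCommGroup K] [Module A K] [Module S K] [IsScalarTower S A K]
    [AddCommGroup P] [Module A P] [Module S P] [IsScalarTower S A P]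
    [AddCommGroup M] [Module A M] [Module S M] [IsScalarTower S A M]
    {f : K →ₗ[A] P} {g : P →ₗ[A] M} (hf : Function.Injective f)
    (hg : Function.Surjective g) (hfg : Function.Exact f g)
    (hP : Subsingleton (Ext (ModuleCat.of S P) (ModuleCat.of S S) 2))
    (hM : Subsingleton (Ext (ModuleCat.of A M) (ModuleCat.of A A) 1)) :
    Subsingleton (Ext (ModuleCat.of S M) (ModuleCat.of S S) 2) := by
  have hS := shortExact_of_exact (f := f.restrictScalars S) (g := g.restrictScalars S) hf hg hfg
  refine subsingleton_of_forall_eq 0 fun e ↦ ?_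
  obtain ⟨e', rfl⟩ := Ext.contravariant_sequence_exact₃ hS
    (ModuleCat.of S S) e (hP.elim _ _) (n₀ := 1) rfl
  obtain ⟨φ, rfl⟩ := h.exists_extClass_eq (fun k : K ↦ h.smul_eq_zero k) e'
  obtain ⟨ψ, hψ⟩ := exists_extension_of_ext_one hf hg hfg hM
    (φ.extendScalarsOfSurjective h.surjective)
  have hψ' : ModuleCat.ofHom φ =
      ModuleCat.ofHom (f.restrictScalars S) ≫ ModuleCat.ofHom (ψ.restrictScalars S) := by
    ext k
    exact (LinearMap.congr_fun hψ k).symm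
  rw [hψ', ← Ext.mk₀_comp_mk₀, Ext.comp_assoc_of_second_deg_zero]
  exact hS.extClass_comp_assoc _

/-- Vanishing of `Ext_A^{>0}(M, A)` forces vanishing of `Ext_S^{>1}(M, S)`. -/
theorem subsingleton_ext_of_extSelfVanishes (h : IsRegularQuotient S A x) (i : ℕ)
    (M : Type u) [AddCommGroup M] [Module A M] [Module S M] [IsScalarTower S A M]
    (hM : ExtSelfVanishes A M) :
    Subsingleton (Ext (ModuleCat.of S M) (ModuleCat.of S S) (i + 2)) := by
  induction i generalizing M with
  | zero =>
    have hg := Finsupp.linearCombination_id_surjective A M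
    generalize Finsupp.linearCombination A (id : M → M) = g at hg
    exact h.subsingleton_ext_two (K := LinearMap.ker g) (f := (LinearMap.ker g).subtype) (g := g)
      (LinearMap.ker g).injective_subtype hg (LinearMap.exact_subtype_ker_map g)
      (h.subsingleton_ext_finsupp M 2 le_rfl) (hM 1 one_pos)
  | succ i ih =>
    have hg := Finsupp.linearCombination_id_surjective A M
    generalize Finsupp.linearCombination A (id : M → M) = g at hg
    have hK : ExtSelfVanishes A (LinearMap.ker g) := fun j hj ↦
      subsingleton_ext_of_exact_left (f := (LinearMap.ker g).subtype) (g := g)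
        (LinearMap.ker g).injective_subtype hg
        (LinearMap.exact_subtype_ker_map g) j (subsingleton_ext_of_projective j hj)
        (hM (j + 1) j.succ_pos)
    exact subsingleton_ext_of_exact_right
      (f := ((LinearMap.ker g).subtype.restrictScalars S : LinearMap.ker g →ₗ[S] (M →₀ A)))
      (g := (g.restrictScalars S : (M →₀ A) →ₗ[S] M))
      (LinearMap.ker g).injective_subtype hg (LinearMap.exact_subtype_ker_map g) (i + 2)
      (ih (LinearMap.ker g) hK) (h.subsingleton_ext_finsupp M _ (by lia))

theorem exists_smul_eq (h : IsRegularQuotient S A x) {F : Type*} [AddCommGroup F] [Module S F]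
    (g : F →ₗ[S] S) (hg : ∀ v, x ∣ g v) : ∃ k : F →ₗ[S] S, ∀ v, g v = x * k v := by
  choose k hk using hg
  refine ⟨{ toFun := k, map_add' := fun v w ↦ ?_, map_smul' := fun c v ↦ ?_ }, hk⟩
  · apply h.mul_cancel
    rw [mul_add, ← hk, ← hk, ← hk, map_add]
  · apply h.mul_cancel
    simp only [RingHom.id_apply, smul_eq_mul]
    rw [← hk, map_smul, hk, smul_eq_mul, mul_left_comm]

/-! ### The syzygy and its dual -/

section Syzygy

variable {M F : Type u} [AddCommGroup M] [Module A M] [Module S M] [IsScalarTower S A M]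
  [AddCommGroup F] [Module S F] (h : IsRegularQuotient S A x) (p : F →ₗ[S] M)

/-- Multiplication by `x`, as a map from `F` to the kernel of `F → M`. -/
def toSyzygy : F →ₗ[S] LinearMap.ker p :=
  (x • LinearMap.id).codRestrict _ fun v ↦ by simp [h.smul_eq_zero]

@[simp]
theorem coe_toSyzygy (v : F) : (h.toSyzygy p v : F) = x • v := rfl

theorem toSyzygy_coe (n : LinearMap.ker p) : h.toSyzygy p n = x • n := rfl

variable {p} (hp : Function.Surjective p)

include hp in
theorem exists_dual_apply_eq (f : Module.Dual S (LinearMap.ker p)) :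
    ∃ α : Module.Dual A M, ∀ v, α (p v) = algebraMap S A (f (h.toSyzygy p v)) := by
  let g : F →ₗ[S] A := Algebra.linearMap S A ∘ₗ f ∘ₗ h.toSyzygy p
  have hg : LinearMap.ker p ≤ LinearMap.ker g := fun v hv ↦ by
    have : h.toSyzygy p v = x • (⟨v, hv⟩ : LinearMap.ker p) := rfl
    change algebraMap S A (f (h.toSyzygy p v)) = 0
    rw [this, map_smul, smul_eq_mul, map_mul, h.algebraMap_self, zero_mul]
  let e := p.quotKerEquivOfSurjective hp
  refine ⟨((LinearMap.ker p).liftQ g hg ∘ₗ e.symm.toLinearMap).extendScalarsOfSurjective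
    h.surjective, fun v ↦ ?_⟩
  have : e.symm (p v) = (LinearMap.ker p).mkQ v := by
    rw [LinearEquiv.symm_apply_eq]; rfl
  change (LinearMap.ker p).liftQ g hg (e.symm (p v)) = _
  rw [this]
  rfl

/-- The map `N* → M*` for `N` the kernel of `F → M`; it sends `f` to the map induced by
`v ↦ f (x v)`. -/
noncomputable def dualSyzygy : Module.Dual S (LinearMap.ker p) →ₗ[S] Module.Dual A M where
  toFun f := (h.exists_dual_apply_eq hp f).choose
  map_add' f g := by
    ext m
    obtain ⟨v, rfl⟩ := hp m
    refine ((h.exists_dual_apply_eq hp (f + g)).choose_spec v).trans ?_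
    simp only [LinearMap.add_apply, (h.exists_dual_apply_eq hp _).choose_spec, map_add]
  map_smul' c f := by
    ext m
    obtain ⟨v, rfl⟩ := hp m
    refine ((h.exists_dual_apply_eq hp (c • f)).choose_spec v).trans ?_
    simp only [LinearMap.smul_apply, RingHom.id_apply, (h.exists_dual_apply_eq hp _).choose_spec,
      smul_eq_mul, map_mul, Algebra.smul_def]

theorem dualSyzygy_apply (f : Module.Dual S (LinearMap.ker p)) (v : F) :
    h.dualSyzygy hp f (p v) = algebraMap S A (f (h.toSyzygy p v)) :=
  (h.exists_dual_apply_eq hp f).choose_spec v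

include h in
theorem dualMap_subtype_injective :
    Function.Injective (LinearMap.ker p).subtype.dualMap := fun f g hfg ↦ by
  ext v
  apply h.mul_cancel
  simpa using LinearMap.congr_fun hfg (h.toSyzygy p v)

theorem dualSyzygy_exact :
    Function.Exact (LinearMap.ker p).subtype.dualMap (h.dualSyzygy hp) := fun f ↦ by
  constructor
  · intro hf
    have hd : ∀ v, x ∣ f (h.toSyzygy p v) := fun v ↦ by
      rw [← h.algebraMap_eq_zero_iff, ← h.dualSyzygy_apply hp, hf, LinearMap.zero_apply]
    obtain ⟨k, hk⟩ := h.exists_smul_eq (f ∘ₗ h.toSyzygy p) hd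
    refine ⟨k, LinearMap.ext fun n ↦ h.mul_cancel ?_⟩
    change x * k n = _
    rw [← hk n, LinearMap.comp_apply, toSyzygy_coe, map_smul, smul_eq_mul]
  · rintro ⟨k, rfl⟩
    ext m
    obtain ⟨v, rfl⟩ := hp m
    simp [dualSyzygy_apply, h.algebraMap_self]

/-- Lift `α ∘ p` to `g : F → S`. On the syzygy `g` is divisible by `x`, and the quotient `g / x` is
the preimage. -/
theorem dualSyzygy_surjective [Module.Projective S F] :
    Function.Surjective (h.dualSyzygy hp) := fun α ↦ by
  obtain ⟨g, hg⟩ := Module.projective_lifting_property (Algebra.linearMap S A)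
    (α.restrictScalars S ∘ₗ p) h.surjective
  replace hg : ∀ v, algebraMap S A (g v) = α (p v) := LinearMap.congr_fun hg
  obtain ⟨f, hf⟩ := h.exists_smul_eq (g ∘ₗ (LinearMap.ker p).subtype) fun n ↦ by
    rw [← h.algebraMap_eq_zero_iff, LinearMap.comp_apply, hg]
    simp
  refine ⟨f, LinearMap.ext fun m ↦ ?_⟩
  obtain ⟨v, rfl⟩ := hp m
  rw [dualSyzygy_apply, ← hg]
  congr 1
  apply h.mul_cancel
  rw [← hf]
  simp

include h hp in
/-- First syzygies over `S` of totally reflexive `S/(x)`-modules are totally reflexive. -/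
theorem isTotallyReflexive_ker [IsNoetherianRing S] [IsNoetherianRing A] [Module.Free S F]
    [Module.Finite S F] (hM : IsTotallyReflexive A M) :
    IsTotallyReflexive S (LinearMap.ker p) where
  finite := inferInstance
  bijective_eval := by
    constructor
    · refine (injective_iff_map_eq_zero _).2 fun n hn ↦ Subtype.ext ?_
      refine (Module.bijective_dual_eval S F).1 ?_
      ext k
      simpa using LinearMap.congr_fun hn ((LinearMap.ker p).subtype.dualMap k)
    · intro Φ
      -- `Φ` pulled back to `F**` is evaluation at some `v`, the candidate preimage. Every
      -- functional on `M` kills `p v`, so `v` lies in the syzygy.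
      obtain ⟨v, hv⟩ := (Module.bijective_dual_eval S F).2 (Φ ∘ₗ (LinearMap.ker p).subtype.dualMap)
      replace hv : ∀ k : Module.Dual S F, k v = Φ ((LinearMap.ker p).subtype.dualMap k) :=
        fun k ↦ LinearMap.congr_fun hv k
      have hf : ∀ f, f (h.toSyzygy p v) = x * Φ f := fun f ↦ by
        have : (LinearMap.ker p).subtype.dualMap (f ∘ₗ h.toSyzygy p) = x • f := by
          ext n
          simp [toSyzygy_coe]
        rw [← smul_eq_mul, ← map_smul, ← this, ← hv, LinearMap.comp_apply]
      have hpv : p v = 0 := by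
        refine (injective_iff_map_eq_zero _).1 hM.bijective_eval.1 _ (LinearMap.ext fun α ↦ ?_)
        obtain ⟨f, rfl⟩ := h.dualSyzygy_surjective hp α
        rw [Module.Dual.eval_apply, dualSyzygy_apply, hf, map_mul, h.algebraMap_self, zero_mul]
        rfl
      refine ⟨⟨v, hpv⟩, LinearMap.ext fun f ↦ h.mul_cancel ?_⟩
      rw [← hf, Module.Dual.eval_apply, ← smul_eq_mul, ← map_smul]
      rfl
  ext_self i hi := by
    obtain ⟨i, rfl⟩ := Nat.exists_eq_add_of_lt hi
    exact subsingleton_ext_of_exact_left (LinearMap.ker p).injective_subtype hp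
      p.exact_subtype_ker_map _ (subsingleton_ext_of_projective _ hi)
      (by simpa using h.subsingleton_ext_of_extSelfVanishes i M hM.ext_self)
  ext_dual i hi := by
    rcases i with _ | _ | i
    · exact absurd hi (lt_irrefl 0)
    -- The class comes from some `φ : M* → A`. By reflexivity `φ` is evaluation at `p v`, so its
    -- pullback to `N*` lifts to evaluation at `xv ∈ N` with values in `S`, and the connecting map
    -- kills it.
    · refine subsingleton_of_forall_eq 0 fun e ↦ ?_
      have hS := shortExact_of_exact h.dualMap_subtype_injective (h.dualSyzygy_surjective hp)
        (h.dualSyzygy_exact hp)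
      obtain ⟨e', rfl⟩ := Ext.contravariant_sequence_exact₂ hS (ModuleCat.of S S) e
        ((subsingleton_ext_of_projective 1 one_pos).elim _ _)
      obtain ⟨φ, rfl⟩ := h.exists_extClass_eq (fun α ↦ h.smul_eq_zero α) e'
      obtain ⟨m, hm⟩ := hM.bijective_eval.2 (φ.extendScalarsOfSurjective h.surjective)
      obtain ⟨v, rfl⟩ := hp m
      have hφ : φ ∘ₗ h.dualSyzygy hp =
          Algebra.linearMap S A ∘ₗ Module.Dual.eval S _ (h.toSyzygy p v) := by
        ext f
        have := LinearMap.congr_fun hm (h.dualSyzygy hp f)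
        rw [Module.Dual.eval_apply, dualSyzygy_apply] at this
        exact this.symm
      rw [← h.mk₀_comp_extClass_eq_zero (Module.Dual.eval S _ (h.toSyzygy p v)), ← hφ,
        ModuleCat.ofHom_comp, ← Ext.mk₀_comp_mk₀, Ext.comp_assoc_of_second_deg_zero]
    · refine subsingleton_ext_of_exact_middle h.dualMap_subtype_injective
        (h.dualSyzygy_surjective hp) (h.dualSyzygy_exact hp) _
        (subsingleton_ext_of_projective _ hi)
        (h.subsingleton_ext_of_extSelfVanishes i _ hM.ext_dual)

end Syzygy

end IsRegularQuotient

/-! ### Minimal covers and descent of freeness -/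

open IsLocalRing

/-- A finitely generated module over a local ring is a quotient of a finite free module by a
submodule of `𝔪 F`. -/
theorem IsLocalRing.exists_minimal_cover {S : Type*} [CommRing S] [IsLocalRing S] (M : Type*) [AddCommGroup M]
    [Module S M] [Module.Finite S M] :
    ∃ (n : ℕ) (p : (Fin n → S) →ₗ[S] M), Function.Surjective p ∧
      ∀ v, p v = 0 → ∀ i, v i ∈ maximalIdeal S := by
  let b := Module.finBasis (ResidueField S) (TensorProduct S (ResidueField S) M)
  have hs : ∀ i, ∃ m : M, TensorProduct.mk S (ResidueField S) M 1 m = b i := fun i ↦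
    TensorProduct.mk_surjective S M (ResidueField S) residue_surjective (b i)
  choose m hm using hs
  refine ⟨_, Fintype.linearCombination S m, ?_, fun v hv i ↦ ?_⟩
  · rw [← LinearMap.range_eq_top, Fintype.range_linearCombination]
    exact span_eq_top_of_tmul_eq_basis m b hm
  · rw [← residue_eq_zero_iff]
    refine Fintype.linearIndependent_iff.1 b.linearIndependent (fun i ↦ residue S (v i)) ?_ i
    rw [Fintype.linearCombination_apply] at hv
    have := congrArg (TensorProduct.mk S (ResidueField S) M 1) hv
    rw [map_sum, map_zero] at this
    rw [← this]
    refine Finset.sum_congr rfl fun j _ ↦ ?_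
    rw [map_smul, hm, ← algebraMap_smul (ResidueField S) (v j) (b j)]
    rfl

namespace IsRegularQuotient

variable {S A : Type u} [CommRing S] [CommRing A] [Algebra S A] {x : S}

/-- If a first syzygy over `S` of an `S/(x)`-module `M` is free and `x ∉ 𝔪²`, then `M` is free
over `S/(x)`. -/
theorem free_of_free_ker [IsLocalRing S] [IsNoetherianRing S] (h : IsRegularQuotient S A x)
    (hx2 : x ∉ maximalIdeal S ^ 2) {M : Type u} [AddCommGroup M]
    [Module A M] [Module S M] [IsScalarTower S A M] {n : ℕ} (p : (Fin n → S) →ₗ[S] M)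
    (hp : Function.Surjective p) (hmin : ∀ v, p v = 0 → ∀ i, v i ∈ maximalIdeal S)
    [Module.Free S (LinearMap.ker p)] : Module.Free A M := by
  have hinj : Function.Injective (h.toSyzygy p) := fun v w hvw ↦ by
    ext i
    exact h.mul_cancel (congrFun (congrArg Subtype.val hvw) i)
  have hrank : Module.finrank S (LinearMap.ker p) = n := by
    apply le_antisymm
    · simpa using LinearMap.finrank_le_finrank_of_injective (LinearMap.ker p).injective_subtype
    · simpa using LinearMap.finrank_le_finrank_of_injective hinj
  let b : Module.Basis (Fin n) S (LinearMap.ker p) := Module.finBasisOfFinrankEq _ _ hrank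
  let B := LinearMap.toMatrix (Pi.basisFun S (Fin n)) b (h.toSyzygy p)
  -- A kernel vector of `B` over the residue field lifts to `v` with a unit coordinate and `xv ∈ 𝔪N
  -- ⊆ 𝔪²F`, against `x ∉ 𝔪²`.
  have hB : IsUnit B.det := by
    rw [← residue_ne_zero_iff_isUnit, RingHom.map_det]
    intro hdet
    obtain ⟨w, hw0, hw⟩ := Matrix.exists_mulVec_eq_zero_iff.2 hdet
    choose v hv using fun i ↦ residue_surjective (w i)
    refine hw0 (funext fun i ↦ ?_)
    rw [← hv i, Pi.zero_apply, residue_eq_zero_iff]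
    by_contra hi
    have hmem : ∀ j, b.repr (h.toSyzygy p v) j ∈ maximalIdeal S := fun j ↦ by
      rw [← residue_eq_zero_iff, ← LinearMap.toMatrix_mulVec_repr (Pi.basisFun S (Fin n)) b]
      have hvw : residue S ∘ v = w := funext hv
      rw [← hvw] at hw
      exact (RingHom.map_mulVec _ _ _ _).trans (congrFun hw j)
    have hsum : x * v i = ∑ j, b.repr (h.toSyzygy p v) j * (b j : Fin n → S) i := by
      have := congrArg (fun k : LinearMap.ker p ↦ (k : Fin n → S) i)
        (b.sum_repr (h.toSyzygy p v))
      simpa [-Module.Basis.sum_repr, Finset.sum_apply] using this.symm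
    have hxv : x * v i ∈ maximalIdeal S ^ 2 := by
      rw [hsum, pow_two]
      exact Ideal.sum_mem _ fun j _ ↦ Ideal.mul_mem_mul (hmem j) (hmin _ (b j).2 i)
    have hu : IsUnit (v i) := by simpa using hi
    exact hx2 ((Ideal.unit_mul_mem_iff_mem _ hu).1 (by rwa [mul_comm]))
  have hsurj : Function.Surjective (h.toSyzygy p) := (LinearEquiv.ofIsUnitDet hB).surjective
  let m : Fin n → M := fun i ↦ p (Pi.single i 1)
  have hsum : ∀ v : Fin n → S, p v = ∑ i, algebraMap S A (v i) • m i := fun v ↦ by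
    conv_lhs => rw [← (Pi.basisFun S (Fin n)).sum_repr v]
    simp [m, -Module.Basis.sum_repr]
  refine Module.Free.of_basis (Module.Basis.mk (v := m) ?_ ?_)
  · rw [Fintype.linearIndependent_iff]
    intro a ha i
    choose v hv using fun i ↦ h.surjective (a i)
    have hpv : p v = 0 := by rw [hsum, ← ha]; simp only [hv]
    obtain ⟨w, hw⟩ := hsurj ⟨v, hpv⟩
    rw [← hv, h.algebraMap_eq_zero_iff]
    exact ⟨w i, (congrFun (congrArg Subtype.val hw) i).symm⟩
  · intro y _
    obtain ⟨v, rfl⟩ := hp y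
    rw [hsum]
    exact Submodule.sum_mem _ fun i _ ↦ Submodule.smul_mem _ _ (Submodule.subset_span ⟨i, rfl⟩)

/-- If `S` is G-regular and `x ∉ 𝔪²` is a nonzerodivisor, then `S/(x)` is G-regular. -/
theorem isGRegular [IsNoetherianRing S] [IsLocalRing S] [IsNoetherianRing A] [IsLocalRing A]
    (h : IsRegularQuotient S A x) (hx2 : x ∉ maximalIdeal S ^ 2) (hS : IsGRegular S) :
    IsGRegular A := fun M _ _ hM ↦ by
  let : Module S M := Module.compHom M (algebraMap S A)
  have : IsScalarTower S A M := .of_algebraMap_smul fun _ _ ↦ rfl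
  have := hM.finite
  have : Module.Finite S A := .of_surjective (Algebra.linearMap S A) h.surjective
  have : Module.Finite S M := .trans A M
  obtain ⟨n, p, hp, hmin⟩ := exists_minimal_cover (S := S) M
  have := hS _ (h.isTotallyReflexive_ker hp hM)
  exact h.free_of_free_ker hx2 p hp hmin

end IsRegularQuotient

/-! ### The hypersurface `S/(xy)` -/

theorem proposition831903 (S : Type u) [CommRing S] [IsNoetherianRing S] [IsLocalRing S]
    (hS : IsGRegular S) (x y : S)
    (hx_mem : x ∈ IsLocalRing.maximalIdeal S) (hy_mem : y ∈ IsLocalRing.maximalIdeal S)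
    (hx : x ∈ nonZeroDivisors S) (hy : y ∈ nonZeroDivisors S)
    (hx2 : x ∉ IsLocalRing.maximalIdeal S ^ 2)
    (hdim : 2 ≤ ringKrullDim (S ⧸ Ideal.span {x, y})) :
    let R := S ⧸ Ideal.span {x * y}
    let x' : R := Ideal.Quotient.mk (Ideal.span {x * y}) x
    let y' : R := Ideal.Quotient.mk (Ideal.span {x * y}) y
    (∃ _ : IsLocalRing R, IsExactZerodivisorPair x' y') ∧
      2 ≤ ringKrullDim (R ⧸ Ideal.span {x', y'}) ∧
      (∃ _ : IsLocalRing (R ⧸ Ideal.span {x'}), IsGRegular (R ⧸ Ideal.span {x'})) := by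
  intro R x' y'
  have hne : Ideal.span {x * y} ≠ ⊤ := fun he ↦
    (Ideal.ne_top_iff_one _).1 (maximalIdeal.isMaximal S).ne_top
      ((Ideal.span_singleton_le_iff_mem _).2 (Ideal.mul_mem_right y _ hx_mem)
        (he ▸ Submodule.mem_top))
  have : Nontrivial R := Ideal.Quotient.nontrivial_iff.2 hne
  have hR : IsLocalRing R := .of_surjective' (Ideal.Quotient.mk _) Ideal.Quotient.mk_surjective
  have hmem : ∀ s ∈ maximalIdeal S, Ideal.Quotient.mk (Ideal.span {x * y}) s ∈ maximalIdeal R :=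
    fun s hs ↦ by
      have : ((maximalIdeal R).comap (Ideal.Quotient.mk (Ideal.span {x * y}))).IsMaximal :=
        Ideal.comap_isMaximal_of_surjective _ Ideal.Quotient.mk_surjective
      rw [← eq_maximalIdeal this] at hs
      exact hs
  have hcolon : ∀ a b : S, a ∈ nonZeroDivisors S → a * b = x * y →
      (⊥ : Ideal R).colon {Ideal.Quotient.mk (Ideal.span {x * y}) a} =
        Ideal.span {Ideal.Quotient.mk (Ideal.span {x * y}) b} := fun a b ha hab ↦ by
    ext r
    obtain ⟨r, rfl⟩ := Ideal.Quotient.mk_surjective r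
    rw [Submodule.mem_colon_singleton, smul_eq_mul, ← map_mul, Ideal.mem_bot,
      Ideal.Quotient.eq_zero_iff_mem, Ideal.mem_span_singleton, Ideal.mem_span_singleton,
      mul_comm r a]
    constructor
    · rintro ⟨c, hc⟩
      exact map_dvd _ ⟨c, (mul_cancel_left_mem_nonZeroDivisors ha).1 (by rw [hc, ← hab, mul_assoc])⟩
    · rintro ⟨c, hc⟩
      obtain ⟨c, rfl⟩ := Ideal.Quotient.mk_surjective c
      rw [← map_mul, Ideal.Quotient.eq, Ideal.mem_span_singleton, ← neg_sub, dvd_neg] at hc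
      have := dvd_sub ((hab ▸ dvd_mul_right (a * b) c : x * y ∣ a * b * c)) (hc.mul_left a)
      convert this using 1
      ring
  have hxI : Ideal.map (Ideal.Quotient.mk (Ideal.span {x * y})) (Ideal.span {x, y}) =
      Ideal.span {x', y'} := by
    rw [Ideal.map_span, Set.image_pair]
  have hle : Ideal.span {x * y} ≤ Ideal.span {x, y} := by
    rw [Ideal.span_singleton_le_iff_mem]
    exact Ideal.mul_mem_right _ _ (Ideal.subset_span (by simp))
  have hx' : x' ∈ maximalIdeal R := hmem x hx_mem
  have hne' : Ideal.span {x'} ≠ ⊤ := fun he ↦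
    (Ideal.ne_top_iff_one _).1 (maximalIdeal.isMaximal R).ne_top
      ((Ideal.span_singleton_le_iff_mem _).2 hx' (he ▸ Submodule.mem_top))
  have : Nontrivial (R ⧸ Ideal.span {x'}) := Ideal.Quotient.nontrivial_iff.2 hne'
  have hA : IsLocalRing (R ⧸ Ideal.span {x'}) :=
    .of_surjective' (Ideal.Quotient.mk _) Ideal.Quotient.mk_surjective
  refine ⟨⟨hR, hx', hmem y hy_mem, hcolon x y hx rfl, hcolon y x hy (mul_comm _ _)⟩, ?_, hA, ?_⟩
  · rw [← hxI, ringKrullDim_eq_of_ringEquiv (DoubleQuot.quotQuotEquivQuotOfLE hle)]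
    exact hdim
  · refine IsRegularQuotient.isGRegular (S := S) (x := x) ⟨?_, fun s ↦ ?_, hx⟩ hx2 hS
    · exact Ideal.Quotient.mk_surjective.comp Ideal.Quotient.mk_surjective
    · change Ideal.Quotient.mk (Ideal.span {x'}) (Ideal.Quotient.mk (Ideal.span {x * y}) s) = 0 ↔ _
      rw [Ideal.Quotient.eq_zero_iff_mem, Ideal.mem_span_singleton]
      constructor
      · rintro ⟨c, hc⟩
        obtain ⟨c, rfl⟩ := Ideal.Quotient.mk_surjective c
        rw [← map_mul, Ideal.Quotient.eq, Ideal.mem_span_singleton] at hc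
        have := dvd_add ((dvd_mul_right x y).trans hc) (dvd_mul_right x c)
        simpa using this
      · exact map_dvd _
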